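/- For a partition $\lambda$ of a nonnegative integer $n$, let $\mathcal{O}(\lambda)$ be the number of odd parts of $\lambda$ (counted with multiplicity) and let $\lambda'$ be the conjugate partition. Let $u(n)$ be the number of partitions $\lambda$ of $n$ with $\mathcal{O}(\lambda)\not\equiv\mathcal{O}(\lambda')\pmod 4$; equivalently $u(n)=p(n)-t(n)$, where $p(n)$ is the number of all partitions of $n$ and $t(n)$ (Stanley's partition function) is the number of those with $\mathcal{O}(\lambda)\equiv\mathcal{O}(\lambda')\pmod 4$. Write $(a;q)_\infty=\prod_{k\ge 0}(1-aq^k)$ and $$V(q)=\frac{(q^2;q^2)_\infty^2\,(q^8;q^8)_\infty^2}{(q;q)_\infty^5\,(q^4;q^4)_\infty}.$$ Then for every complex number $q$ with $|q|<1$ the following four series converge absolutely, and $$\sum_{n=0}^{\infty}u(4n)q^{n}=2q^2(q^{16};q^{16})_{\infty}(-q;q^{16})_{\infty}(-q^{15};q^{16})_{\infty}V(q),$$ $$\sum_{n=0}^{\infty}u(4n+1)q^{n}=2q(q^{16};q^{16})_{\infty}(-q^{3};q^{16})_{\infty}(-q^{13};q^{16})_{\infty}V(q),$$ $$\sum_{n=0}^{\infty}u(4n+2)q^{n}=2(q^{16};q^{16})_{\infty}(-q^{7};q^{16})_{\infty}(-q^{9};q^{16})_{\infty}V(q),$$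 $$\sum_{n=0}^{\infty}u(4n+3)q^{n}=2(q^{16};q^{16})_{\infty}(-q^{5};q^{16})_{\infty}(-q^{11};q^{16})_{\infty}V(q).$$ -/

import Mathlib

namespace StanleyPartition

/-- The conjugate `λ'` of a partition `λ` of `n`: its `i`-th part (`i = 1, 2, …`) is the number of
parts of `λ` that are at least `i`. Since no part exceeds `n`, only `i ≤ n` can give a positive
number, and `Nat.Partition.ofSums` discards the zeros. The index below is `i - 1`. -/
def conjugate {n : ℕ} (p : n.Partition) : n.Partition :=
  Nat.Partition.ofSums n
    ((Multiset.range n).map fun i => p.parts.countP fun a => i + 1 ≤ a) (by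
      have key : ∀ s : Multiset ℕ, (∀ a ∈ s, a ≤ n) →
          ((Multiset.range n).map fun i => s.countP fun a => i + 1 ≤ a).sum = s.sum := by
        intro s
        induction s using Multiset.induction_on with
        | empty => intro _; simp
        | cons a s ih =>
          intro h
          have h1 : a ≤ n := h a (Multiset.mem_cons_self a s)
          have h2 := ih fun b hb => h b (Multiset.mem_cons_of_mem hb)
          have h3 : ((Multiset.range n).map fun i => if i + 1 ≤ a then 1 else 0).sum = a := by
            change ∑ i ∈ Finset.range n, (if i + 1 ≤ a then 1 else 0) = a
            rw [← Finset.card_filter]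
            have : (Finset.range n).filter (fun i => i + 1 ≤ a) = Finset.range a := by
              ext i
              simp only [Finset.mem_filter, Finset.mem_range]
              omega
            rw [this, Finset.card_range]
          simp only [Multiset.countP_cons, Multiset.sum_map_add, Multiset.sum_cons, h2, h3]
          omega
      rw [key p.parts fun _ h => Nat.Partition.le_of_mem_parts h, p.parts_sum])

/-- The number `𝒪(λ)` of odd parts of a partition, counted with multiplicity. -/
def oddParts {n : ℕ} (p : n.Partition) : ℕ :=
  p.parts.countP fun a => Odd a

/-- `u(n)`: the number of partitions `λ` of `n` with `𝒪(λ) ≢ 𝒪(λ') (mod 4)`, that is,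
the number of all partitions of `n` minus Stanley's `t(n)`. -/
def u (n : ℕ) : ℕ :=
  (Finset.univ.filter fun p : n.Partition => ¬ oddParts p ≡ oddParts (conjugate p) [MOD 4]).card

/-- The infinite `q`-shifted factorial `(a; q)_∞ = (1 - a)(1 - a q)(1 - a q²)⋯`. -/
noncomputable def qInf (a q : ℂ) : ℂ :=
  ∏' k : ℕ, (1 - a * q ^ k)

/-- `V(q) = (q²;q²)_∞² (q⁸;q⁸)_∞² / ((q;q)_∞⁵ (q⁴;q⁴)_∞)`. -/
noncomputable def V (q : ℂ) : ℂ :=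
  (qInf (q ^ 2) (q ^ 2) ^ 2 * qInf (q ^ 8) (q ^ 8) ^ 2) /
    (qInf q q ^ 5 * qInf (q ^ 4) (q ^ 4))

end StanleyPartition

open Finset Filter Topology

namespace StanleyPartition

/-! Give a partition the sign +1 if 𝒪(λ) ≡ 𝒪(λ') (mod 4) and -1 otherwise; then 2u(n) is p(n) minus
the signed count. 𝒪(λ') counts the columns of odd height, and adjoining a new largest part N flips
the parity of the first N columns. The effect on the sign depends only on N and |λ|
(`parSign_cons`), so the signed generating function F_N of partitions with parts at most N satisfies
F_N(q) = F_{N-1}(q) + (-1)^⌊N/2⌋ q^N F_N(-q).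

Applying this at q and -q eliminates F_N(-q), and the q-Pascal rule solves the result: with y = -q²,
F_N is the sum over i + j = N of q^{tri(i-j)} / ((y;y)_i (y;y)_j) (`boundedGen_parSign`). Its limit
is ψ(q)/(y;y)_∞², where ψ(q) = ∑ q^{2m²+m} over the integers. Gauss's product for ψ gives 1/(q;q)_∞
= ψ(q)/(q²;q²)_∞², so ψ factors out of ∑ 2u(n)qⁿ. What remains is a difference of inverse squares,
which a theta identity evaluates as 4q²V(q⁴) (`inv_sq_sub_inv_sq`). Hence ∑ u(n)qⁿ = 2q²V(q⁴)ψ(q)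
(`tsum_u_eq`).

Since V(q⁴) involves only fourth powers, dissecting the left side modulo 4 means dissecting ψ. The
residue of 2m²+m modulo 4 determines m modulo 4, and each class is again a theta series, summed by
the Jacobi triple product. -/

/-! ### Column parities and the sign of a partition. -/

/-- The number of indices `i < B` for which the number of parts of `s` exceeding `i` is odd. -/
def oddColumns (B : ℕ) (s : Multiset ℕ) : ℕ :=
  #{i ∈ range B | Odd (s.countP fun a => i + 1 ≤ a)}

lemma oddColumns_eq {B C : ℕ} {s : Multiset ℕ} (hBC : B ≤ C) (h : ∀ a ∈ s, a ≤ B) :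
    oddColumns C s = oddColumns B s := by
  unfold oddColumns
  congr 1
  ext i
  simp only [mem_filter, mem_range]
  constructor
  · rintro ⟨hi, ho⟩
    refine ⟨?_, ho⟩
    obtain ⟨a, ha, hia⟩ := Multiset.countP_pos.1 ho.pos
    have := h a ha
    omega
  · rintro ⟨hi, ho⟩
    exact ⟨by omega, ho⟩

lemma oddParts_conjugate {n : ℕ} (p : n.Partition) :
    oddParts (conjugate p) = oddColumns n p.parts := by
  unfold oddParts conjugate oddColumns
  simp only [Nat.Partition.ofSums, Multiset.countP_filter]
  -- The zeros discarded by `ofSums` are not odd, so the filter does not affect the count.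
  rw [Multiset.countP_congr rfl (p' := fun a => Odd a), Multiset.countP_map]
  · rfl
  · intro a _
    simp only [ne_eq, and_iff_left_iff_imp, eq_iff_iff]
    rintro h rfl
    simp at h

/-- Adjoining a new largest part complements the parities of the columns. -/
lemma oddColumns_cons {N : ℕ} {s : Multiset ℕ} :
    oddColumns N (N ::ₘ s) + oddColumns N s = N := by
  have h : #{i ∈ range N | Odd (s.countP fun a => i + 1 ≤ a)} +
      #{i ∈ range N | ¬ Odd (s.countP fun a => i + 1 ≤ a)} = #(range N) :=
    card_filter_add_card_filter_not _
  rw [card_range] at h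
  have h' : oddColumns N (N ::ₘ s) = #{i ∈ range N | ¬ Odd (s.countP fun a => i + 1 ≤ a)} := by
    unfold oddColumns
    refine congrArg card ?_
    ext i
    simp only [mem_filter, mem_range]
    refine and_congr_right fun hi => ?_
    rw [Multiset.countP_cons, if_pos (by omega), Nat.odd_add_one]
  rw [h', add_comm]
  exact h

/-- The column heights add up to the size of the partition. -/
lemma oddColumns_mod_two {N : ℕ} (s : Multiset ℕ) (h : ∀ a ∈ s, a ≤ N) :
    oddColumns N s % 2 = s.sum % 2 := by
  have key : oddColumns N s % 2 = (∑ i ∈ range N, s.countP fun a => i + 1 ≤ a) % 2 := by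
    rw [Finset.sum_nat_mod, oddColumns, card_filter, Finset.sum_nat_mod]
    congr 1
    refine Finset.sum_congr rfl fun i _ => ?_
    rcases Nat.even_or_odd (s.countP fun a => i + 1 ≤ a) with h | h
    · rw [if_neg (Nat.not_odd_iff_even.2 h), Nat.even_iff.1 h]
    · rw [if_pos h, Nat.odd_iff.1 h]
  rw [key]
  congr 1
  clear key
  induction s using Multiset.induction_on with
  | empty => simp
  | cons a s ih =>
    have ha : a ≤ N := h a (Multiset.mem_cons_self a s)
    simp only [Multiset.countP_cons, sum_add_distrib, Multiset.sum_cons,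
      ih fun b hb => h b (Multiset.mem_cons_of_mem hb)]
    rw [← card_filter, add_comm]
    congr 1
    have : (range N).filter (fun i => i + 1 ≤ a) = range a := by
      ext i
      simp only [mem_filter, mem_range]
      omega
    rw [this, card_range]

lemma countP_odd_mod_two (s : Multiset ℕ) : (s.countP fun a => Odd a) % 2 = s.sum % 2 := by
  induction s using Multiset.induction_on with
  | empty => simp
  | cons a s ih =>
    rw [Multiset.countP_cons, Multiset.sum_cons]
    split_ifs with h
    · rw [Nat.odd_iff] at h; omega
    · rw [Nat.not_odd_iff] at h; omega

/-- The sign of a multiset of parts: `1` if `𝒪(λ) ≡ 𝒪(λ') (mod 4)`, and `-1` otherwise. -/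
noncomputable def parSign (s : Multiset ℕ) : ℂ :=
  if (s.countP fun a => Odd a) ≡ oddColumns s.sum s [MOD 4] then 1 else -1

lemma parSign_eq {N : ℕ} {s : Multiset ℕ} (h : ∀ a ∈ s, a ≤ N) :
    parSign s = if (s.countP fun a => Odd a) ≡ oddColumns N s [MOD 4] then 1 else -1 := by
  have : oddColumns s.sum s = oddColumns N s := by
    rcases le_total s.sum N with h' | h'
    · exact (oddColumns_eq h' fun a ha => Multiset.le_sum_of_mem ha).symm
    · exact oddColumns_eq h' h
  rw [parSign, this]

lemma norm_parSign (s : Multiset ℕ) : ‖parSign s‖ = 1 := by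
  unfold parSign
  split_ifs <;> simp

lemma neg_one_pow_eq_ite (n : ℕ) : (-1 : ℂ) ^ n = if n % 2 = 0 then 1 else -1 := by
  split_ifs with h
  · exact (Nat.even_iff.2 h).neg_one_pow
  · exact (Nat.odd_iff.2 (by omega)).neg_one_pow

/-- 𝒪 grows by N mod 2 and 𝒪' becomes N - 𝒪', so 𝒪 - 𝒪' changes by 2(𝒪' - ⌊N/2⌋). This matters
modulo 4 only through the parities of ⌊N/2⌋ and of 𝒪' ≡ |s|. -/
lemma parSign_cons {N : ℕ} {s : Multiset ℕ} (h : ∀ a ∈ s, a ≤ N) :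
    parSign (N ::ₘ s) = (-1) ^ (N / 2) * (-1) ^ s.sum * parSign s := by
  have h1 : ∀ a ∈ N ::ₘ s, a ≤ N := by
    intro a ha
    rcases Multiset.mem_cons.1 ha with rfl | ha
    · exact le_rfl
    · exact h a ha
  rw [parSign_eq h, parSign_eq h1, neg_one_pow_eq_ite, neg_one_pow_eq_ite]
  have h2 := oddColumns_cons (N := N) (s := s)
  have h3 := oddColumns_mod_two s h
  have h4 := countP_odd_mod_two s
  have h5 : (N ::ₘ s).countP (fun a => Odd a) = s.countP (fun a => Odd a) + N % 2 := by
    rw [Multiset.countP_cons]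
    split_ifs with h
    · rw [Nat.odd_iff.1 h]
    · rw [Nat.not_odd_iff.1 h]
  rw [h5]
  generalize oddColumns N s = A at *
  generalize oddColumns N (N ::ₘ s) = B at *
  generalize s.countP (fun a => Odd a) = C at *
  generalize s.sum = S at *
  clear h1 h h5
  unfold Nat.ModEq
  by_cases c1 : N / 2 % 2 = 0 <;> by_cases c2 : S % 2 = 0 <;> by_cases c3 : C % 4 = A % 4 <;>
    by_cases c4 : (C + N % 2) % 4 = B % 4 <;>
    first
    | (exfalso; omega)
    | (simp only [c1, c2, c3, c4, if_true, if_false]; norm_num)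

/-! ### Weighted partition counts and recursion on the largest part. -/

/-- The weighted number of partitions of `n` into parts at most `N`. -/
noncomputable def boundedSum (w : Multiset ℕ → ℂ) (N n : ℕ) : ℂ :=
  ∑ p ∈ (univ : Finset n.Partition) with ∀ a ∈ p.parts, a ≤ N, w p.parts

/-- The weighted number of partitions of `n`. -/
noncomputable def totalSum (w : Multiset ℕ → ℂ) (n : ℕ) : ℂ :=
  ∑ p : n.Partition, w p.parts

lemma boundedSum_eq_totalSum (w : Multiset ℕ → ℂ) {N n : ℕ} (h : n ≤ N) :
    boundedSum w N n = totalSum w n := by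
  unfold boundedSum totalSum
  rw [filter_true_of_mem]
  intro p _ a ha
  exact (Nat.Partition.le_of_mem_parts ha).trans h

lemma boundedSum_zero (w : Multiset ℕ → ℂ) (n : ℕ) :
    boundedSum w 0 n = if n = 0 then w 0 else 0 := by
  unfold boundedSum
  split_ifs with h
  · subst h
    rw [filter_true_of_mem, Fintype.sum_unique]
    · congr 1
    · intro p _ a ha
      exact Nat.Partition.le_of_mem_parts ha
  · rw [filter_false_of_mem, sum_empty]
    intro p _ hp
    obtain ⟨a, ha⟩ := Multiset.exists_mem_of_ne_zero (s := p.parts) (by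
      intro h0
      have := p.parts_sum
      rw [h0] at this
      exact h this.symm)
    have := p.parts_pos ha
    have := hp a ha
    omega

/-- Classifying partitions with parts at most `N + 1` by whether `N + 1` occurs. -/
lemma boundedSum_succ (w : Multiset ℕ → ℂ) (N n : ℕ) :
    boundedSum w (N + 1) n = boundedSum w N n +
      if N + 1 ≤ n then boundedSum (fun s => w ((N + 1) ::ₘ s)) (N + 1) (n - (N + 1)) else 0 := by
  unfold boundedSum
  rw [← sum_filter_add_sum_filter_not _ (fun p : n.Partition => ∀ a ∈ p.parts, a ≤ N)]
  congr 1
  · rw [filter_filter]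
    refine sum_congr (filter_congr fun p _ => ?_) fun _ _ => rfl
    exact ⟨fun h => h.2, fun h => ⟨fun a ha => (h a ha).trans (Nat.le_succ N), h⟩⟩
  rw [filter_filter]
  have hmem : ∀ p ∈ (univ : Finset n.Partition).filter
      (fun p => (∀ a ∈ p.parts, a ≤ N + 1) ∧ ¬ ∀ a ∈ p.parts, a ≤ N), N + 1 ∈ p.parts := by
    intro p hp
    obtain ⟨_, h1, h2⟩ := mem_filter.1 hp
    push Not at h2
    obtain ⟨a, ha, h3⟩ := h2
    have := h1 a ha
    rwa [show N + 1 = a by omega]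
  split_ifs with h
  · refine sum_bij'
      (i := fun p hp => ⟨p.parts.erase (N + 1), fun {a} ha => p.parts_pos (Multiset.mem_of_mem_erase ha), by
        have h1 := Multiset.sum_erase (hmem p hp)
        rw [p.parts_sum] at h1
        omega⟩)
      (j := fun p _ => ⟨(N + 1) ::ₘ p.parts, fun {a} ha => by
        rcases Multiset.mem_cons.1 ha with rfl | ha
        · omega
        · exact p.parts_pos ha, by
        rw [Multiset.sum_cons, p.parts_sum]
        omega⟩) ?_ ?_ ?_ ?_ ?_
    · intro p hp
      refine mem_filter.2 ⟨mem_univ _, fun a ha => ?_⟩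
      exact (mem_filter.1 hp).2.1 a (Multiset.mem_of_mem_erase ha)
    · intro p hp
      refine mem_filter.2 ⟨mem_univ _, fun a ha => ?_, fun h' => ?_⟩
      · rcases Multiset.mem_cons.1 ha with rfl | ha
        · exact le_rfl
        · exact (mem_filter.1 hp).2 a ha
      · have := h' (N + 1) (Multiset.mem_cons_self _ _)
        omega
    · intro p hp
      ext1
      exact Multiset.cons_erase (hmem p hp)
    · intro p hp
      ext1
      exact Multiset.erase_cons_head _ _
    · intro p hp
      simp only
      rw [Multiset.cons_erase (hmem p hp)]
  · refine sum_eq_zero fun p hp => ?_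
    exact absurd (Nat.Partition.le_of_mem_parts (hmem p hp)) h

lemma boundedSum_parSign_succ (N n : ℕ) :
    boundedSum parSign (N + 1) n = boundedSum parSign N n +
      if N + 1 ≤ n then (-1) ^ ((N + 1) / 2) * (-1) ^ (n - (N + 1)) *
        boundedSum parSign (N + 1) (n - (N + 1)) else 0 := by
  rw [boundedSum_succ]
  congr 2
  unfold boundedSum
  rw [mul_sum]
  refine sum_congr rfl fun p hp => ?_
  simp only
  rw [parSign_cons (mem_filter.1 hp).2, p.parts_sum]

lemma boundedSum_one_succ (N n : ℕ) :
    boundedSum (fun _ => 1) (N + 1) n = boundedSum (fun _ => 1) N n +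
      if N + 1 ≤ n then boundedSum (fun _ => 1) (N + 1) (n - (N + 1)) else 0 :=
  boundedSum_succ _ N n

lemma norm_boundedSum_le {w : Multiset ℕ → ℂ} (hw : ∀ s, ‖w s‖ ≤ 1) (N n : ℕ) :
    ‖boundedSum w N n‖ ≤ Fintype.card n.Partition := by
  refine (norm_sum_le _ _).trans ?_
  refine (sum_le_card_nsmul _ _ 1 fun p _ => hw _).trans ?_
  rw [nsmul_eq_mul, mul_one]
  exact_mod_cast card_filter_le _ _

lemma totalSum_one (n : ℕ) : totalSum (fun _ => 1) n = Fintype.card n.Partition := by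
  simp [totalSum]

lemma two_mul_u (n : ℕ) :
    2 * (u n : ℂ) = totalSum (fun _ => 1) n - totalSum parSign n := by
  unfold totalSum u
  rw [← sum_sub_distrib, card_filter, Nat.cast_sum, mul_sum]
  refine sum_congr rfl fun p _ => ?_
  rw [parSign_eq (N := n) fun a ha => Nat.Partition.le_of_mem_parts ha, oddParts_conjugate]
  unfold oddParts
  split_ifs <;> norm_num

lemma u_le (n : ℕ) : u n ≤ Fintype.card n.Partition := card_filter_le _ _

/-- Lets the recursion compute u(0), …, u(3), the constant terms needed at q = 0. -/
lemma u_eq_boundedSum {n : ℕ} (hn : n ≤ 3) :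
    (u n : ℂ) = (boundedSum (fun _ => 1) 3 n - boundedSum parSign 3 n) / 2 := by
  rw [boundedSum_eq_totalSum _ hn, boundedSum_eq_totalSum _ hn, ← two_mul_u]
  ring

lemma parSign_zero : parSign 0 = 1 := by
  simp [parSign, oddColumns, Nat.ModEq]

lemma u_zero : (u 0 : ℂ) = 0 := by
  rw [u_eq_boundedSum (by norm_num)]
  simp [boundedSum_parSign_succ, boundedSum_one_succ, boundedSum_zero, parSign_zero]

lemma u_one : (u 1 : ℂ) = 0 := by
  rw [u_eq_boundedSum (by norm_num)]
  simp [boundedSum_parSign_succ, boundedSum_one_succ, boundedSum_zero, parSign_zero]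

lemma u_two : (u 2 : ℂ) = 2 := by
  rw [u_eq_boundedSum (by norm_num)]
  simp [boundedSum_parSign_succ, boundedSum_one_succ, boundedSum_zero, parSign_zero]
  norm_num

lemma u_three : (u 3 : ℂ) = 2 := by
  rw [u_eq_boundedSum (by norm_num)]
  simp [boundedSum_parSign_succ, boundedSum_one_succ, boundedSum_zero, parSign_zero]
  norm_num

/-! ### Triangular exponents and theta series. -/

section Triangular

/-- The triangular number `n (n + 1) / 2` of an integer `n`. -/
def tri (n : ℤ) : ℕ := (n * (n + 1) / 2).toNat

/-- The product n(n+1) is even and nonnegative, so neither the division nor `toNat` loses anything.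
-/
lemma two_mul_tri (n : ℤ) : 2 * (tri n : ℤ) = n * (n + 1) := by
  obtain ⟨k, hk⟩ := (Int.even_mul_succ_self n)
  have h0 : 0 ≤ n * (n + 1) := by
    rcases le_or_gt 0 n with h | h
    · positivity
    · exact mul_nonneg_of_nonpos_of_nonpos h.le (by omega)
  unfold tri
  omega

lemma tri_add_one (n : ℤ) : (tri (n + 1) : ℤ) = tri n + n + 1 := by
  have h1 := two_mul_tri n
  have h2 := two_mul_tri (n + 1)
  linarith

lemma tri_eq (n : ℤ) : (tri n : ℤ) = tri (n - 1) + n := by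
  have h1 := two_mul_tri n
  have h2 := two_mul_tri (n - 1)
  linarith

lemma tri_neg (n : ℤ) : tri (-n) = tri (n - 1) := by
  have h1 := two_mul_tri (-n)
  have h2 := two_mul_tri (n - 1)
  have : (tri (-n) : ℤ) = tri (n - 1) := by linarith
  exact_mod_cast this

/-- The `n`-th term of Ramanujan's theta series. -/
noncomputable def thetaTerm (a b : ℂ) (n : ℤ) : ℂ := a ^ tri n * b ^ tri (n - 1)

/-- Ramanujan's theta series `∑ a ^ (n (n + 1) / 2) * b ^ (n (n - 1) / 2)`. -/
noncomputable def theta (a b : ℂ) : ℂ := ∑' n : ℤ, thetaTerm a b n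

lemma thetaTerm_neg (a b : ℂ) (n : ℤ) : thetaTerm a b (-n) = thetaTerm b a n := by
  have h : -n - 1 = -(n + 1) := by ring
  rw [thetaTerm, thetaTerm, tri_neg, h, tri_neg, add_sub_cancel_right, mul_comm]

/-- Consecutive terms have ratio a(ab)ⁿ, which tends to 0. -/
lemma summable_thetaTerm_nat {a b : ℂ} (h : ‖a * b‖ < 1) :
    Summable fun n : ℕ => thetaTerm a b n := by
  have hlim : Tendsto (fun n : ℕ => ‖a * (a * b) ^ n‖) atTop (𝓝 0) := by
    have := (tendsto_pow_atTop_nhds_zero_of_norm_lt_one h).const_mul a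
    simpa using this.norm
  refine summable_of_ratio_norm_eventually_le (r := 1 / 2) (by norm_num) ?_
  filter_upwards [hlim.eventually_le_const (show (0 : ℝ) < 1 / 2 by norm_num)] with n hn
  have : thetaTerm a b ((n + 1 : ℕ) : ℤ) = a * (a * b) ^ n * thetaTerm a b n := by
    unfold thetaTerm
    have h1 : tri ((n + 1 : ℕ) : ℤ) = 1 + n + tri n := by
      have := tri_add_one n
      push_cast
      omega
    have h2 : tri (((n + 1 : ℕ) : ℤ) - 1) = n + tri ((n : ℤ) - 1) := by
      have := tri_eq n
      push_cast
      rw [add_sub_cancel_right]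
      omega
    rw [h1, h2, pow_add, pow_add, pow_add, mul_pow, pow_one]
    ring
  rw [this, norm_mul]
  gcongr

lemma summable_thetaTerm {a b : ℂ} (h : ‖a * b‖ < 1) : Summable (thetaTerm a b) := by
  refine Summable.of_nat_of_neg_add_one (summable_thetaTerm_nat h) ?_
  simp only [thetaTerm_neg]
  have := (summable_nat_add_iff 1).2 (summable_thetaTerm_nat (a := b) (b := a) (by rwa [mul_comm]))
  simpa using this

end Triangular

/-! ### q-factorials and the Jacobi triple product. -/

section Factorials

/-- The finite `q`-factorial `(c; c)_n`. -/
noncomputable def qFin (c : ℂ) (n : ℕ) : ℂ := ∏ k ∈ range n, (1 - c ^ (k + 1))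

lemma one_sub_pow_ne_zero {c : ℂ} (hc : ‖c‖ < 1) (k : ℕ) : 1 - c ^ (k + 1) ≠ 0 := by
  intro h
  have h1 : ‖c ^ (k + 1)‖ = 1 := by rw [← sub_eq_zero.1 h, norm_one]
  rw [norm_pow] at h1
  exact (pow_lt_one₀ (norm_nonneg c) hc (Nat.succ_ne_zero k)).ne h1

lemma qFin_ne_zero {c : ℂ} (hc : ‖c‖ < 1) (n : ℕ) : qFin c n ≠ 0 :=
  prod_ne_zero_iff.2 fun k _ => one_sub_pow_ne_zero hc k

lemma qFin_succ (c : ℂ) (n : ℕ) : qFin c (n + 1) = qFin c n * (1 - c ^ (n + 1)) :=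
  prod_range_succ _ n

lemma summable_norm_mul_pow (a : ℂ) {c : ℂ} (hc : ‖c‖ < 1) :
    Summable fun k : ℕ => ‖-(a * c ^ k)‖ := by
  simp only [norm_neg, norm_mul, norm_pow]
  exact (summable_geometric_of_lt_one (norm_nonneg c) hc).mul_left _

lemma multipliable_qInf (a : ℂ) {c : ℂ} (hc : ‖c‖ < 1) :
    Multipliable fun k : ℕ => 1 - a * c ^ k := by
  simpa only [sub_eq_add_neg] using multipliable_one_add_of_summable (summable_norm_mul_pow a hc)

lemma tendsto_qInf (a : ℂ) {c : ℂ} (hc : ‖c‖ < 1) :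
    Tendsto (fun n => ∏ k ∈ range n, (1 - a * c ^ k)) atTop (𝓝 (qInf a c)) :=
  (multipliable_qInf a hc).hasProd.tendsto_prod_nat

lemma qInf_self_ne_zero {c : ℂ} (hc : ‖c‖ < 1) : qInf c c ≠ 0 := by
  have := tprod_one_add_ne_zero_of_summable (f := fun k : ℕ => -(c * c ^ k))
    (fun k => by
      rw [← sub_eq_add_neg, ← pow_succ']
      exact one_sub_pow_ne_zero hc k) (summable_norm_mul_pow c hc)
  simpa only [qInf, ← sub_eq_add_neg] using this

lemma tendsto_qFin {c : ℂ} (hc : ‖c‖ < 1) : Tendsto (qFin c) atTop (𝓝 (qInf c c)) := by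
  refine (tendsto_qInf c hc).congr fun n => ?_
  simp only [qFin, pow_succ']

/-- Both Pascal rules for the `q`-binomial coefficients, in terms of a general numerator. -/
lemma sum_antidiagonal_qFin {c : ℂ} (hc : ‖c‖ < 1) (t : ℕ → ℕ → ℂ) (L : ℕ) :
    (1 - c ^ (L + 1)) * ∑ p ∈ antidiagonal (L + 1), t p.1 p.2 / (qFin c p.1 * qFin c p.2) =
      ∑ p ∈ antidiagonal L, (c ^ p.2 * t (p.1 + 1) p.2 + t p.1 (p.2 + 1)) /
        (qFin c p.1 * qFin c p.2) := by
  -- For i + j = L + 1, write 1 - c^(i+j) = c^j(1 - c^i) + (1 - c^j); each piece cancels the last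
  -- factor of one of the two factorials.
  have h1 : (1 - c ^ (L + 1)) * ∑ p ∈ antidiagonal (L + 1), t p.1 p.2 / (qFin c p.1 * qFin c p.2) =
      ∑ p ∈ antidiagonal (L + 1), c ^ p.2 * (1 - c ^ p.1) * t p.1 p.2 / (qFin c p.1 * qFin c p.2) +
      ∑ p ∈ antidiagonal (L + 1), (1 - c ^ p.2) * t p.1 p.2 / (qFin c p.1 * qFin c p.2) := by
    rw [mul_sum, ← sum_add_distrib]
    refine sum_congr rfl fun p hp => ?_
    rw [← HasAntidiagonal.mem_antidiagonal.1 hp, pow_add]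
    ring
  rw [h1, Nat.sum_antidiagonal_succ, Nat.sum_antidiagonal_succ' (n := L) (f := fun p =>
    (1 - c ^ p.2) * t p.1 p.2 / (qFin c p.1 * qFin c p.2))]
  simp only [pow_zero, sub_self, mul_zero, zero_mul, zero_div, zero_add]
  rw [← sum_add_distrib]
  refine sum_congr rfl fun p _ => ?_
  have h2 := qFin_ne_zero hc p.1
  have h3 := qFin_ne_zero hc p.2
  have h4 := one_sub_pow_ne_zero hc p.1
  have h5 := one_sub_pow_ne_zero hc p.2
  rw [qFin_succ, qFin_succ]
  field_simp

lemma sum_antidiagonal_qFin' {c : ℂ} (hc : ‖c‖ < 1) (t : ℕ → ℕ → ℂ) (L : ℕ) :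
    (1 - c ^ (L + 1)) * ∑ p ∈ antidiagonal (L + 1), t p.1 p.2 / (qFin c p.1 * qFin c p.2) =
      ∑ p ∈ antidiagonal L, (c ^ p.1 * t p.1 (p.2 + 1) + t (p.1 + 1) p.2) /
        (qFin c p.1 * qFin c p.2) := by
  have h := sum_antidiagonal_qFin hc (fun i j => t j i) L
  rw [← Nat.sum_antidiagonal_swap, ← Nat.sum_antidiagonal_swap (n := L)] at h
  simp only [Prod.fst_swap, Prod.snd_swap] at h
  convert h using 3 <;> rw [mul_comm (qFin c _)]

/-- The factorials converge to a nonzero limit. The bound serves both the dominated limit below and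
the convergence of the partition series. -/
lemma norm_inv_qFin_bound {c : ℂ} (hc : ‖c‖ < 1) : ∃ C : ℝ, ∀ n, ‖(qFin c n)⁻¹‖ ≤ C := by
  obtain ⟨C, hC⟩ := ((tendsto_qFin hc).inv₀ (qInf_self_ne_zero hc)).norm.bddAbove_range
  exact ⟨C, fun n => hC ⟨n, rfl⟩⟩

/-- The limit of a sum against central `q`-binomial coefficients. -/
lemma tendsto_sum_antidiagonal_qFin {c : ℂ} (hc : ‖c‖ < 1) {t : ℤ → ℂ} (ht : Summable t) :
    Tendsto (fun N : ℕ => ∑ p ∈ antidiagonal (2 * N),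
      t ((p.1 : ℤ) - N) / (qFin c p.1 * qFin c p.2)) atTop (𝓝 ((∑' n, t n) / qInf c c ^ 2)) := by
  obtain ⟨C, hC⟩ := norm_inv_qFin_bound hc
  have hC0 : 0 ≤ C := (norm_nonneg _).trans (hC 0)
  -- Centring the index at N and extending by zero puts all the finite sums on ℤ.
  let f : ℕ → ℤ → ℂ := fun N n => if n ∈ Icc (-(N : ℤ)) N then
    t n * ((qFin c (n + N).toNat)⁻¹ * (qFin c (N - n).toNat)⁻¹) else 0
  have hf : ∀ N : ℕ, ∑ p ∈ antidiagonal (2 * N), t ((p.1 : ℤ) - N) / (qFin c p.1 * qFin c p.2) =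
      ∑' n, f N n := by
    intro N
    rw [tsum_eq_sum (s := Icc (-(N : ℤ)) N) fun n hn => if_neg hn]
    refine sum_bij' (i := fun p _ => (p.1 : ℤ) - N)
      (j := fun n _ => ((n + N).toNat, (N - n).toNat)) ?_ ?_ ?_ ?_ ?_
    · intro p hp
      have := HasAntidiagonal.mem_antidiagonal.1 hp
      rw [mem_Icc]
      omega
    · intro n hn
      rw [mem_Icc] at hn
      rw [HasAntidiagonal.mem_antidiagonal]
      omega
    · intro p hp
      have := HasAntidiagonal.mem_antidiagonal.1 hp
      ext <;> simp only <;> omega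
    · intro n hn
      rw [mem_Icc] at hn
      simp only
      omega
    · intro p hp
      have := HasAntidiagonal.mem_antidiagonal.1 hp
      have hm : (p.1 : ℤ) - N ∈ Icc (-(N : ℤ)) N := by
        rw [mem_Icc]
        omega
      have h1 : ((p.1 : ℤ) - N + N).toNat = p.1 := by omega
      have h2 : ((N : ℤ) - ((p.1 : ℤ) - N)).toNat = p.2 := by omega
      simp only [if_pos hm, h1, h2]
      rw [div_eq_mul_inv, mul_inv]
  simp only [hf]
  have hlim : (∑' n, t n) / qInf c c ^ 2 = ∑' n, t n * ((qInf c c)⁻¹ * (qInf c c)⁻¹) := by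
    rw [tsum_mul_right, div_eq_mul_inv, sq, mul_inv]
  rw [hlim]
  refine tendsto_tsum_of_dominated_convergence (bound := fun n => ‖t n‖ * (C * C))
    (ht.norm.mul_right _) ?_ (Eventually.of_forall ?_)
  · intro n
    have hinv := (tendsto_qFin hc).inv₀ (qInf_self_ne_zero hc)
    have h1 : Tendsto (fun N : ℕ => (n + N).toNat) atTop atTop :=
      tendsto_atTop_mono (f := fun N : ℕ => N - n.natAbs) (fun N => by omega)
        (tendsto_sub_atTop_nat _)
    have h2 : Tendsto (fun N : ℕ => ((N : ℤ) - n).toNat) atTop atTop :=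
      tendsto_atTop_mono (f := fun N : ℕ => N - n.natAbs) (fun N => by omega)
        (tendsto_sub_atTop_nat _)
    refine (((hinv.comp h1).mul (hinv.comp h2)).const_mul (t n)).congr' ?_
    filter_upwards [eventually_ge_atTop n.natAbs] with N hN
    have hm : n ∈ Icc (-(N : ℤ)) N := by
      rw [mem_Icc]
      omega
    simp only [f, if_pos hm, Function.comp_apply]
  · intro N n
    simp only [f]
    split_ifs
    · rw [norm_mul, norm_mul]
      gcongr <;> apply hC
    · rw [norm_zero]
      positivity

/-- The finite form of the Jacobi triple product. -/
lemma finite_triple_product {a b : ℂ} (h : ‖a * b‖ < 1) (N M : ℕ) :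
    (∏ k ∈ range N, (1 + a * (a * b) ^ k)) * ∏ k ∈ range M, (1 + b * (a * b) ^ k) =
      qFin (a * b) (N + M) * ∑ p ∈ antidiagonal (N + M),
        thetaTerm a b ((p.1 : ℤ) - M) / (qFin (a * b) p.1 * qFin (a * b) p.2) := by
  induction N with
  | zero =>
    induction M with
    | zero => simp [qFin, thetaTerm, tri]
    | succ M ih =>
      rw [prod_range_succ, ← mul_assoc, ih, ← add_assoc, qFin_succ, mul_assoc, mul_assoc,
        sum_antidiagonal_qFin' h (fun i j => thetaTerm a b ((i : ℤ) - ((M + 1 : ℕ) : ℤ))), sum_mul]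
      congr 1
      refine sum_congr rfl fun p hp => ?_
      rw [div_mul_eq_mul_div]
      congr 1
      have hp' : p.1 + p.2 = M := by simpa using hp
      have e1 : ((p.1 + 1 : ℕ) : ℤ) - ((M + 1 : ℕ) : ℤ) = (p.1 : ℤ) - M := by push_cast; ring
      have e2 : (p.1 : ℤ) - ((M + 1 : ℕ) : ℤ) = (p.1 : ℤ) - M - 1 := by push_cast; ring
      rw [e1, e2, mul_add, mul_one, add_comm]
      congr 1
      unfold thetaTerm
      have h1 := tri_eq ((p.1 : ℤ) - M)
      have h2 := tri_eq ((p.1 : ℤ) - M - 1)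
      have h3 : p.1 + tri ((p.1 : ℤ) - M - 1) = M + tri ((p.1 : ℤ) - M) := by omega
      have h4 : p.1 + tri ((p.1 : ℤ) - M - 1 - 1) = 1 + M + tri ((p.1 : ℤ) - M - 1) := by omega
      calc _ = a ^ tri ((p.1 : ℤ) - M) * b ^ tri ((p.1 : ℤ) - M - 1) * (b * (a ^ M * b ^ M)) := by
            rw [mul_pow]
        _ = a ^ (M + tri ((p.1 : ℤ) - M)) * b ^ (1 + M + tri ((p.1 : ℤ) - M - 1)) := by
            rw [pow_add, pow_add, pow_add]; ring
        _ = _ := by rw [← h3, ← h4, pow_add, pow_add, mul_pow]; ring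
  | succ N ih =>
    have hL : N + 1 + M = N + M + 1 := by ring
    rw [prod_range_succ, mul_right_comm, ih, hL, qFin_succ, mul_assoc, mul_assoc,
      sum_antidiagonal_qFin h (fun i j => thetaTerm a b ((i : ℤ) - M)), sum_mul]
    congr 1
    refine sum_congr rfl fun p hp => ?_
    rw [div_mul_eq_mul_div]
    congr 1
    have hp' : p.1 + p.2 = N + M := by simpa using hp
    have e1 : ((p.1 + 1 : ℕ) : ℤ) - M = (p.1 : ℤ) - M + 1 := by push_cast; ring
    rw [e1, mul_add, mul_one, add_comm]
    congr 1
    unfold thetaTerm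
    rw [add_sub_cancel_right]
    have h1 := tri_eq ((p.1 : ℤ) - M)
    have h2 := tri_add_one ((p.1 : ℤ) - M)
    have h3 : p.2 + tri ((p.1 : ℤ) - M + 1) = 1 + N + tri ((p.1 : ℤ) - M) := by omega
    have h4 : p.2 + tri ((p.1 : ℤ) - M) = N + tri ((p.1 : ℤ) - M - 1) := by omega
    calc _ = a ^ tri ((p.1 : ℤ) - M) * b ^ tri ((p.1 : ℤ) - M - 1) * (a * (a ^ N * b ^ N)) := by
          rw [mul_pow]
      _ = a ^ (1 + N + tri ((p.1 : ℤ) - M)) * b ^ (N + tri ((p.1 : ℤ) - M - 1)) := by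
          rw [pow_add, pow_add, pow_add]; ring
      _ = _ := by rw [← h3, ← h4, pow_add, pow_add, mul_pow]; ring

/-- The Jacobi triple product identity. -/
theorem theta_eq_qInf {a b : ℂ} (h : ‖a * b‖ < 1) :
    theta a b = qInf (a * b) (a * b) * qInf (-a) (a * b) * qInf (-b) (a * b) := by
  have hE := qInf_self_ne_zero h
  have h1 := (tendsto_qInf (-a) h).mul (tendsto_qInf (-b) h)
  have h2 := ((tendsto_qFin h).comp
    (tendsto_atTop_mono (f := fun N : ℕ => N) (g := fun N => N + N) (fun N => by omega) tendsto_id)).mul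
      (tendsto_sum_antidiagonal_qFin h (summable_thetaTerm h))
  have h3 := tendsto_nhds_unique h1 (h2.congr fun N => by
    have := finite_triple_product h N N
    simp only [neg_mul, sub_neg_eq_add, Function.comp_apply, two_mul]
    exact this.symm)
  rw [mul_assoc, h3]
  unfold theta
  field_simp

end Factorials

/-! ### Convergence and generating functions. -/

section Summability

/-- The number of partitions of `n` into parts at most `N`. -/
def boundedCard (N n : ℕ) : ℕ := #{p : n.Partition | ∀ a ∈ p.parts, a ≤ N}

lemma boundedSum_one (N n : ℕ) : boundedSum (fun _ => 1) N n = boundedCard N n := by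
  simp [boundedSum, boundedCard]

lemma boundedCard_zero (n : ℕ) : boundedCard 0 n = if n = 0 then 1 else 0 := by
  have := boundedSum_zero (fun _ => 1) n
  rw [boundedSum_one] at this
  exact_mod_cast this

lemma boundedCard_succ (N n : ℕ) : boundedCard (N + 1) n = boundedCard N n +
    if N + 1 ≤ n then boundedCard (N + 1) (n - (N + 1)) else 0 := by
  have := boundedSum_one_succ N n
  simp only [boundedSum_one] at this
  exact_mod_cast this

lemma boundedCard_eq {N n : ℕ} (h : n ≤ N) : boundedCard N n = Fintype.card n.Partition := by
  have := boundedSum_eq_totalSum (fun _ => 1) h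
  rw [boundedSum_one, totalSum_one] at this
  exact_mod_cast this

lemma sum_range_shift (g : ℕ → ℝ) (m K : ℕ) :
    ∑ n ∈ range K, (if m ≤ n then g (n - m) else 0) = ∑ n ∈ range (K - m), g n := by
  induction K with
  | zero => simp
  | succ K ih =>
    rw [sum_range_succ, ih]
    split_ifs with h
    · rw [Nat.succ_sub h, sum_range_succ]
    · rw [show K + 1 - m = K - m by omega, add_zero]

/-- The recursion gives S ≤ (sum for N) + x^(N+1) S, which is solved for S. Working with partial
sums avoids presupposing convergence. -/
lemma sum_boundedCard_le {x : ℝ} (hx0 : 0 ≤ x) (hx1 : x < 1) (N K : ℕ) :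
    ∑ n ∈ range K, (boundedCard N n : ℝ) * x ^ n ≤ ∏ k ∈ range N, (1 - x ^ (k + 1))⁻¹ := by
  induction N with
  | zero =>
    simp only [boundedCard_zero, range_zero, prod_empty]
    calc _ ≤ ∑ n ∈ range (K + 1), (((if n = 0 then 1 else 0 : ℕ) : ℝ)) * x ^ n :=
          sum_le_sum_of_subset_of_nonneg (range_mono (Nat.le_succ K)) fun _ _ _ => by positivity
      _ = 1 := by
          rw [sum_range_succ']
          simp
      _ ≤ 1 := le_rfl
  | succ N ih =>
    set S := ∑ n ∈ range K, (boundedCard (N + 1) n : ℝ) * x ^ n with hS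
    have hpos : 0 < 1 - x ^ (N + 1) := sub_pos.2 (pow_lt_one₀ hx0 hx1 (Nat.succ_ne_zero N))
    have h1 : S ≤ ∑ n ∈ range K, (boundedCard N n : ℝ) * x ^ n + x ^ (N + 1) * S := by
      have h2 : S = ∑ n ∈ range K, (boundedCard N n : ℝ) * x ^ n +
          ∑ n ∈ range (K - (N + 1)), x ^ (N + 1) * ((boundedCard (N + 1) n : ℝ) * x ^ n) := by
        rw [hS, ← sum_range_shift, ← sum_add_distrib]
        refine sum_congr rfl fun n _ => ?_
        rw [boundedCard_succ]
        split_ifs with h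
        · obtain ⟨k, rfl⟩ := Nat.exists_eq_add_of_le h
          rw [Nat.add_sub_cancel_left]
          push_cast
          ring
        · simp
      rw [← mul_sum] at h2
      refine h2.le.trans ?_
      gcongr
      exact sum_le_sum_of_subset_of_nonneg (range_mono (Nat.sub_le _ _)) fun _ _ _ => by positivity
    rw [prod_range_succ, ← div_eq_mul_inv, le_div_iff₀ hpos]
    linarith

lemma summable_card_partition {x : ℝ} (hx0 : 0 ≤ x) (hx1 : x < 1) :
    Summable fun n : ℕ => (Fintype.card n.Partition : ℝ) * x ^ n := by
  have hx : ‖(x : ℂ)‖ < 1 := by rwa [Complex.norm_real, Real.norm_of_nonneg hx0]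
  obtain ⟨C, hC⟩ := norm_inv_qFin_bound hx
  refine summable_of_sum_range_le (c := C) (fun n => by positivity) fun K => ?_
  calc _ = ∑ n ∈ range K, (boundedCard K n : ℝ) * x ^ n :=
        sum_congr rfl fun n hn => by rw [boundedCard_eq (mem_range.1 hn).le]
    _ ≤ ∏ k ∈ range K, (1 - x ^ (k + 1))⁻¹ := sum_boundedCard_le hx0 hx1 K K
    _ = ‖(qFin x K)⁻¹‖ := by
        rw [qFin, norm_inv, norm_prod, prod_inv_distrib]
        congr 1
        refine prod_congr rfl fun k _ => ?_
        rw [← Complex.ofReal_pow, ← Complex.ofReal_one, ← Complex.ofReal_sub, Complex.norm_real,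
          Real.norm_of_nonneg (sub_nonneg.2 (pow_le_one₀ hx0 hx1.le))]
    _ ≤ C := hC K

variable {w : Multiset ℕ → ℂ} {q : ℂ}

lemma norm_boundedSum_mul_le (hw : ∀ s, ‖w s‖ ≤ 1) (q : ℂ) (N n : ℕ) :
    ‖boundedSum w N n * q ^ n‖ ≤ (Fintype.card n.Partition : ℝ) * ‖q‖ ^ n := by
  rw [norm_mul, norm_pow]
  gcongr
  exact norm_boundedSum_le hw N n

lemma summable_boundedSum (hw : ∀ s, ‖w s‖ ≤ 1) (hq : ‖q‖ < 1) (N : ℕ) :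
    Summable fun n => boundedSum w N n * q ^ n :=
  (summable_card_partition (norm_nonneg q) hq).of_norm_bounded (norm_boundedSum_mul_le hw q N)

lemma summable_totalSum (hw : ∀ s, ‖w s‖ ≤ 1) (hq : ‖q‖ < 1) :
    Summable fun n => totalSum w n * q ^ n := by
  refine (summable_card_partition (norm_nonneg q) hq).of_norm_bounded fun n => ?_
  rw [← boundedSum_eq_totalSum w le_rfl]
  exact norm_boundedSum_mul_le hw q n n

lemma summable_u (hq : ‖q‖ < 1) : Summable fun n => (u n : ℂ) * q ^ n := by
  refine (summable_card_partition (norm_nonneg q) hq).of_norm_bounded fun n => ?_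
  rw [norm_mul, norm_pow, Complex.norm_natCast]
  gcongr
  exact u_le n

/-- The generating function of weighted partitions into parts at most `N`. -/
noncomputable def boundedGen (w : Multiset ℕ → ℂ) (N : ℕ) (q : ℂ) : ℂ :=
  ∑' n, boundedSum w N n * q ^ n

lemma tendsto_boundedGen (hw : ∀ s, ‖w s‖ ≤ 1) (hq : ‖q‖ < 1) :
    Tendsto (fun N => boundedGen w N q) atTop (𝓝 (∑' n, totalSum w n * q ^ n)) := by
  refine tendsto_tsum_of_dominated_convergence (summable_card_partition (norm_nonneg q) hq) ?_
    (Eventually.of_forall fun N n => norm_boundedSum_mul_le hw q N n)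
  intro n
  refine tendsto_const_nhds.congr' ?_
  filter_upwards [eventually_ge_atTop n] with N hN
  rw [boundedSum_eq_totalSum w hN]

lemma tsum_shift (g : ℕ → ℂ) (m : ℕ) :
    ∑' n, (if m ≤ n then g (n - m) else 0) = ∑' n, g n := by
  rw [← (add_left_injective m).tsum_eq]
  · simp
  · intro n hn
    by_contra h
    refine hn (if_neg fun hmn => h ⟨n - m, ?_⟩)
    simp only
    omega

lemma boundedGen_zero (w : Multiset ℕ → ℂ) (q : ℂ) : boundedGen w 0 q = w 0 := by
  unfold boundedGen
  rw [tsum_eq_single 0]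
  · simp [boundedSum_zero]
  · intro n hn
    rw [boundedSum_zero, if_neg hn, zero_mul]

lemma boundedGen_one_succ (hq : ‖q‖ < 1) (N : ℕ) :
    boundedGen (fun _ => 1) (N + 1) q =
      boundedGen (fun _ => 1) N q + q ^ (N + 1) * boundedGen (fun _ => 1) (N + 1) q := by
  have hw : ∀ s : Multiset ℕ, ‖(fun _ => 1 : Multiset ℕ → ℂ) s‖ ≤ 1 := by simp
  rw [← sub_eq_iff_eq_add']
  unfold boundedGen
  rw [← (summable_boundedSum hw hq _).tsum_sub (summable_boundedSum hw hq _), ← tsum_mul_left]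
  refine Eq.trans (tsum_congr fun n => ?_) (tsum_shift _ (N + 1))
  rw [boundedSum_one_succ N n]
  split_ifs with h
  · obtain ⟨k, rfl⟩ := Nat.exists_eq_add_of_le h
    rw [Nat.add_sub_cancel_left]
    ring
  · ring

lemma boundedGen_parSign_succ (hq : ‖q‖ < 1) (N : ℕ) :
    boundedGen parSign (N + 1) q = boundedGen parSign N q +
      (-1) ^ ((N + 1) / 2) * q ^ (N + 1) * boundedGen parSign (N + 1) (-q) := by
  have hw := fun s => (norm_parSign s).le
  rw [← sub_eq_iff_eq_add']
  unfold boundedGen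
  rw [← (summable_boundedSum hw hq _).tsum_sub (summable_boundedSum hw hq _), ← tsum_mul_left]
  refine Eq.trans (tsum_congr fun n => ?_) (tsum_shift _ (N + 1))
  rw [boundedSum_parSign_succ N n]
  split_ifs with h
  · obtain ⟨k, rfl⟩ := Nat.exists_eq_add_of_le h
    rw [Nat.add_sub_cancel_left, neg_pow q]
    ring
  · ring

end Summability

/-! ### Closed forms for the unsigned and signed generating functions. -/

section Evaluation

variable {q : ℂ}

lemma boundedGen_one (hq : ‖q‖ < 1) (N : ℕ) :
    boundedGen (fun _ => 1) N q = (qFin q N)⁻¹ := by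
  induction N with
  | zero => simp [boundedGen_zero, qFin]
  | succ N ih =>
    have h := boundedGen_one_succ hq N
    rw [ih] at h
    have h1 := qFin_ne_zero hq N
    have h2 := one_sub_pow_ne_zero hq N
    rw [qFin_succ, mul_inv, ← div_eq_mul_inv, eq_div_iff h2]
    linear_combination h

lemma tsum_totalSum_one (hq : ‖q‖ < 1) :
    ∑' n, totalSum (fun _ => 1) n * q ^ n = (qInf q q)⁻¹ :=
  tendsto_nhds_unique (tendsto_boundedGen (by simp) hq)
    (((tendsto_qFin hq).inv₀ (qInf_self_ne_zero hq)).congr fun N => (boundedGen_one hq N).symm)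

lemma neg_one_pow_congr {m n : ℕ} (h : m % 2 = n % 2) : (-1 : ℂ) ^ m = (-1) ^ n := by
  rw [neg_one_pow_eq_ite, neg_one_pow_eq_ite, h]

/-- The sign bookkeeping for `boundedGen_parSign`: it matches (-1)^j from (-q²)^j with the
recursion's sign and that of (-q)^tri(i-j). -/
lemma tri_sub_mod_two (i j : ℕ) :
    j % 2 = ((i + j + 1) / 2 + tri ((i : ℤ) - j)) % 2 := by
  have h := two_mul_tri ((i : ℤ) - j)
  rcases Nat.even_or_odd' (i + j) with ⟨e, he | he⟩
  · have hd : (i : ℤ) - j = 2 * (e - j) := by omega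
    rw [hd] at h ⊢
    have h' : (tri (2 * ((e : ℤ) - j)) : ℤ) = 2 * (((e : ℤ) - j) * (e - j)) + (e - j) := by linarith
    omega
  · have hd : (i : ℤ) - j = 2 * (e - j) + 1 := by omega
    rw [hd] at h ⊢
    have h' : (tri (2 * ((e : ℤ) - j) + 1) : ℤ) =
        2 * (((e : ℤ) - j) * (e - j)) + 3 * (e - j) + 1 := by linarith
    omega

/-- The signed generating function of partitions into parts at most `N`, a finite form of a
quotient of theta functions. -/
lemma boundedGen_parSign (hq : ‖q‖ < 1) (N : ℕ) :
    boundedGen parSign N q = ∑ p ∈ antidiagonal N,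
      q ^ tri ((p.1 : ℤ) - p.2) / (qFin (-q ^ 2) p.1 * qFin (-q ^ 2) p.2) := by
  have hy : ∀ {q : ℂ}, ‖q‖ < 1 → ‖-q ^ 2‖ < 1 := fun h => by
    rw [norm_neg, norm_pow]
    exact pow_lt_one₀ (norm_nonneg _) h two_ne_zero
  induction N generalizing q with
  | zero => simp [boundedGen_zero, parSign_zero, qFin, tri]
  | succ N ih =>
    have hq' : ‖-q‖ < 1 := by rwa [norm_neg]
    have h1 := boundedGen_parSign_succ hq N
    have h2 := boundedGen_parSign_succ hq' N
    rw [neg_neg] at h2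
    have h3 := ih hq
    have h4 := ih hq'
    have hy2 : -(-q) ^ 2 = -q ^ 2 := by ring
    rw [hy2] at h4
    have hpas := sum_antidiagonal_qFin (hy hq) (fun i j => q ^ tri ((i : ℤ) - j)) N
    refine mul_left_cancel₀ (one_sub_pow_ne_zero (hy hq) N) ?_
    rw [hpas]
    -- Substitute the recursion at -q into the one at q: the two equal signs cancel and the powers
    -- combine to (-q²)^(N+1).
    have h5 : (1 - (-q ^ 2) ^ (N + 1)) * boundedGen parSign (N + 1) q =
        boundedGen parSign N q +
          (-1) ^ ((N + 1) / 2) * q ^ (N + 1) * boundedGen parSign N (-q) := by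
      have h6 : (-1 : ℂ) ^ ((N + 1) / 2) * (-1) ^ ((N + 1) / 2) = 1 := by
        rw [← mul_pow]
        norm_num
      have h7 : (-q ^ 2) ^ (N + 1) = q ^ (N + 1) * (-q) ^ (N + 1) := by
        rw [← mul_pow]
        ring
      rw [h7]
      rw [h2] at h1
      linear_combination h1 + q ^ (N + 1) * (-q) ^ (N + 1) * boundedGen parSign (N + 1) q * h6
    rw [h5, h3, h4]
    -- Swapping i and j replaces tri(i-j) by tri(j-i) = tri(i-j-1), the exponent that the Pascal
    -- rule produces.
    have h8 : ∑ p ∈ antidiagonal N,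
        q ^ tri ((p.1 : ℤ) - p.2) / (qFin (-q ^ 2) p.1 * qFin (-q ^ 2) p.2) =
        ∑ p ∈ antidiagonal N,
        q ^ tri ((p.1 : ℤ) - p.2 - 1) / (qFin (-q ^ 2) p.1 * qFin (-q ^ 2) p.2) := by
      rw [← Nat.sum_antidiagonal_swap]
      refine sum_congr rfl fun p _ => ?_
      rw [Prod.fst_swap, Prod.snd_swap, ← tri_neg, neg_sub, mul_comm (qFin _ p.1)]
    rw [h8, mul_sum, ← sum_add_distrib]
    refine sum_congr rfl fun p hp => ?_
    have hp' : p.1 + p.2 = N := by simpa using hp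
    rw [← mul_div_assoc, ← add_div, add_comm]
    congr 2
    · have e1 : ((p.1 + 1 : ℕ) : ℤ) - p.2 = (p.1 : ℤ) - p.2 + 1 := by
        push_cast
        ring
      have e2 : 2 * p.2 + tri ((p.1 : ℤ) - p.2 + 1) = N + 1 + tri ((p.1 : ℤ) - p.2) := by
        have := tri_add_one ((p.1 : ℤ) - p.2)
        omega
      have e3 := tri_sub_mod_two p.1 p.2
      rw [hp'] at e3
      have e4 : q ^ (2 * p.2) * q ^ tri ((p.1 : ℤ) - p.2 + 1) =
          q ^ (N + 1) * q ^ tri ((p.1 : ℤ) - p.2) := by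
        rw [← pow_add, e2, pow_add]
      have e5 : (-1 : ℂ) ^ p.2 = (-1) ^ ((N + 1) / 2) * (-1) ^ tri ((p.1 : ℤ) - p.2) := by
        rw [neg_one_pow_congr e3, pow_add]
      rw [e1, neg_pow (q ^ 2), ← pow_mul, neg_pow q, mul_assoc ((-1 : ℂ) ^ p.2), e4, e5]
      ring
    · congr 2
      push_cast
      ring

/-- The series `∑ q ^ (2 n ^ 2 + n)` over the integers. -/
noncomputable def psi (q : ℂ) : ℂ := theta (q ^ 3) q

lemma norm_pow_lt_one (hq : ‖q‖ < 1) {k : ℕ} (hk : k ≠ 0) : ‖q ^ k‖ < 1 := by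
  rw [norm_pow]
  exact pow_lt_one₀ (norm_nonneg _) hq hk

lemma tri_two_mul (n : ℤ) : tri (2 * n) = 3 * tri n + tri (n - 1) := by
  have h1 := two_mul_tri (2 * n)
  have h2 := two_mul_tri n
  have h3 := two_mul_tri (n - 1)
  have : (tri (2 * n) : ℤ) = 3 * tri n + tri (n - 1) := by linarith
  exact_mod_cast this

lemma thetaTerm_cube (q : ℂ) (n : ℤ) : thetaTerm (q ^ 3) q n = q ^ tri (2 * n) := by
  rw [thetaTerm, ← pow_mul, ← pow_add, tri_two_mul]

lemma psi_eq_tsum (q : ℂ) : psi q = ∑' n : ℤ, q ^ tri (2 * n) :=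
  tsum_congr (thetaTerm_cube q)

lemma summable_pow_tri_two_mul (hq : ‖q‖ < 1) : Summable fun n : ℤ => q ^ tri (2 * n) := by
  have h : ‖q ^ 3 * q‖ < 1 := by
    rw [← pow_succ]
    exact norm_pow_lt_one hq (by norm_num)
  have h' : Summable fun n => thetaTerm (q ^ 3) q n := summable_thetaTerm h
  simpa only [thetaTerm_cube] using h'

lemma tsum_totalSum_parSign (hq : ‖q‖ < 1) :
    ∑' n, totalSum parSign n * q ^ n = psi q / qInf (-q ^ 2) (-q ^ 2) ^ 2 := by
  have hy : ‖-q ^ 2‖ < 1 := by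
    rw [norm_neg]
    exact norm_pow_lt_one hq two_ne_zero
  -- Even bounds 2N suffice for the limit, and there i - j = 2(i - N), so only the exponents tri(2n)
  -- occur.
  have h1 := (tendsto_boundedGen (fun s => (norm_parSign s).le) hq).comp
    (tendsto_atTop_mono (f := fun N : ℕ => N) (g := fun N => 2 * N) (fun N => by omega) tendsto_id)
  have h2 := tendsto_sum_antidiagonal_qFin hy (summable_pow_tri_two_mul hq)
  rw [psi_eq_tsum]
  refine tendsto_nhds_unique h1 (h2.congr fun N => ?_)
  rw [Function.comp_apply, boundedGen_parSign hq]
  refine sum_congr rfl fun p hp => ?_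
  have hp' : p.1 + p.2 = 2 * N := by simpa using hp
  rw [show (p.1 : ℤ) - p.2 = 2 * ((p.1 : ℤ) - N) by omega]

lemma tsum_u (hq : ‖q‖ < 1) :
    2 * ∑' n, (u n : ℂ) * q ^ n =
      (qInf q q)⁻¹ - psi q / qInf (-q ^ 2) (-q ^ 2) ^ 2 := by
  rw [← tsum_totalSum_one hq, ← tsum_totalSum_parSign hq, ← tsum_mul_left,
    ← (summable_totalSum (by simp) hq).tsum_sub (summable_totalSum (fun s => (norm_parSign s).le) hq)]
  refine tsum_congr fun n => ?_
  rw [← mul_assoc, two_mul_u, sub_mul]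

end Evaluation

/-! ### Product identities. -/

section Products

lemma qInf_split {a c d e : ℂ} (hc : ‖c‖ < 1) (hd : d = c ^ 2) (he : e = a * c) :
    qInf a c = qInf a d * qInf e d := by
  have hd' : ‖d‖ < 1 := hd ▸ norm_pow_lt_one hc two_ne_zero
  have h1 : ∀ k : ℕ, 1 - a * d ^ k = 1 - a * c ^ (2 * k) := fun k => by rw [hd, pow_mul]
  have h2 : ∀ k : ℕ, 1 - e * d ^ k = 1 - a * c ^ (2 * k + 1) := fun k => by
    rw [hd, he, ← pow_mul, pow_succ]
    ring
  have m1 := multipliable_qInf a hd'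
  have m2 := multipliable_qInf e hd'
  unfold qInf
  simp only [h1, h2] at m1 m2 ⊢
  exact (tprod_even_mul_odd (f := fun k => 1 - a * c ^ k) m1 m2).symm

lemma qInf_mul_neg {a b c d e : ℂ} (hc : ‖c‖ < 1) (hb : b = -a) (hd : d = a ^ 2)
    (he : e = c ^ 2) : qInf a c * qInf b c = qInf d e := by
  refine ((multipliable_qInf a hc).tprod_mul (multipliable_qInf b hc)).symm.trans ?_
  refine tprod_congr fun k => ?_
  rw [hb, hd, he, ← pow_mul, mul_comm 2 k, pow_mul]
  ring

lemma qInf_neg_one {c : ℂ} (hc : ‖c‖ < 1) : qInf (-1) c = 2 * qInf (-c) c := by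
  have h : ∀ k : ℕ, 1 - -c * c ^ k = 1 - -1 * c ^ (k + 1) := fun k => by
    rw [pow_succ]
    ring
  have hm : Multipliable fun k : ℕ => 1 - -1 * c ^ (k + 1) :=
    (multipliable_qInf (-c) hc).congr h
  have h1 := tprod_eq_zero_mul' (f := fun k : ℕ => 1 - -1 * c ^ k) hm
  have h2 : 1 - -1 * c ^ 0 = 2 := by
    rw [pow_zero]
    norm_num
  rw [h2] at h1
  exact h1.trans (congrArg _ (tprod_congr h).symm)

variable {q : ℂ}

/-- Gauss's identity: the triple product turns ψ into factors modulo 4, and splitting every other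
product the same way makes the sides agree. -/
lemma psi_mul_qInf (hq : ‖q‖ < 1) : psi q * qInf q q = qInf (q ^ 2) (q ^ 2) ^ 2 := by
  have h2 := norm_pow_lt_one hq (two_ne_zero)
  have h4 : ‖q ^ 3 * q‖ < 1 := by
    rw [← pow_succ]
    exact norm_pow_lt_one hq (by norm_num)
  rw [psi, theta_eq_qInf h4, ← pow_succ,
    qInf_split (a := q) (d := q ^ 2) (e := q ^ 2) hq rfl (by ring),
    qInf_split (a := q ^ 2) (d := q ^ 4) (e := q ^ 4) h2 (by ring) (by ring),
    ← qInf_mul_neg (a := q) (b := -q) (c := q ^ 2) (d := q ^ 2) (e := q ^ 4) h2 rfl rfl (by ring),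
    qInf_split (a := -q) (c := q ^ 2) (d := q ^ 4) (e := -q ^ 3) h2 (by ring) (by ring),
    qInf_split (a := q) (c := q ^ 2) (d := q ^ 4) (e := q ^ 3) h2 (by ring) (by ring)]
  ring

/-- Both series run over squares; the even ones cancel, and the odd ones are (2m+1)² = 8 tri(m) + 1.
-/
lemma theta_sub_theta_neg {x : ℂ} (hx : ‖x‖ < 1) :
    theta x x - theta (-x) (-x) = 2 * x * theta (x ^ 8) 1 := by
  have hx2 : ‖x * x‖ < 1 := by
    rw [← sq]
    exact norm_pow_lt_one hx two_ne_zero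
  have hx2' : ‖-x * -x‖ < 1 := by rwa [neg_mul_neg]
  unfold theta
  rw [← (summable_thetaTerm hx2).tsum_sub (summable_thetaTerm hx2'), ← tsum_mul_left]
  have key : ∀ n : ℤ, ((tri n + tri (n - 1) : ℕ) : ℤ) = n * n := fun n => by
    have h1 := two_mul_tri n
    have h2 := two_mul_tri (n - 1)
    push_cast
    linarith
  have hg : Function.Injective fun m : ℤ => 2 * m + 1 := fun m n h => by
    simp only at h
    omega
  rw [← hg.tsum_eq]
  · refine tsum_congr fun m => ?_
    have h1 := key (2 * m + 1)
    have h2 : tri (2 * m + 1) + tri (2 * m + 1 - 1) = 2 * (4 * tri m) + 1 := by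
      have := two_mul_tri m
      zify at h1 ⊢
      linarith
    simp only [thetaTerm, ← pow_add, h2, one_pow, mul_one, ← pow_mul]
    rw [(odd_two_mul_add_one (4 * tri m)).neg_pow]
    ring
  · intro n hn
    by_contra h
    apply hn
    rcases Int.even_or_odd' n with ⟨m, rfl | rfl⟩
    · have h1 := key (2 * m)
      have h2 : Even (tri (2 * m) + tri (2 * m - 1)) := by
        rw [← Int.even_coe_nat, h1]
        exact ⟨2 * m * m, by ring⟩
      simp only [thetaTerm]
      rw [← pow_add, ← pow_add, h2.neg_pow, sub_self]
    · exact absurd ⟨m, rfl⟩ h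

/-- Pulling (x²;x²)_∞ out of both denominators leaves α = (x;x²)_∞ and β = (-x;x²)_∞. By the triple
product, β² - α² is the preceding theta difference divided by (x²;x²)_∞. -/
lemma inv_sq_sub_inv_sq {x : ℂ} (hx : ‖x‖ < 1) :
    1 / qInf x x ^ 2 - 1 / qInf (-x) (-x) ^ 2 = 4 * x * V (x ^ 2) := by
  have hxn : ‖-x‖ < 1 := by rwa [norm_neg]
  have h2 : ‖x ^ 2‖ < 1 := norm_pow_lt_one hx (by norm_num)
  have h4 : ‖x ^ 4‖ < 1 := norm_pow_lt_one hx (by norm_num)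
  have h8 : ‖x ^ 8‖ < 1 := norm_pow_lt_one hx (by norm_num)
  have n1 := qInf_self_ne_zero hx
  have n2 := qInf_self_ne_zero hxn
  have n3 := qInf_self_ne_zero h2
  have n4 := qInf_self_ne_zero h4
  have n5 := qInf_self_ne_zero h8
  have s1 := qInf_split (a := x) (d := x ^ 2) (e := x ^ 2) hx rfl (by ring)
  have s2 := qInf_split (a := -x) (d := x ^ 2) (e := x ^ 2) hxn (by ring) (by ring)
  have s3 := qInf_mul_neg (a := x) (b := -x) (d := x ^ 2) (e := x ^ 4) h2 rfl rfl (by ring)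
  have s4 := qInf_split (a := x ^ 2) (d := x ^ 4) (e := x ^ 4) h2 (by ring) (by ring)
  have s5 := qInf_mul_neg (a := x ^ 8) (b := -x ^ 8) (d := x ^ 16) (e := x ^ 16) h8 rfl
    (by ring) (by ring)
  have t1 := theta_eq_qInf (a := x) (b := x) (by rwa [← sq])
  have t2 := theta_eq_qInf (a := -x) (b := -x) (by rwa [neg_mul_neg, ← sq])
  have t3 := theta_eq_qInf (a := x ^ 8) (b := 1) (by rwa [mul_one])
  rw [← sq] at t1
  rw [neg_mul_neg, ← sq, neg_neg] at t2
  rw [mul_one, qInf_neg_one h8] at t3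
  have t4 := theta_sub_theta_neg hx
  rw [t1, t2, t3] at t4
  unfold V
  simp only [← pow_mul]
  norm_num only
  rw [← s3] at s4
  rw [← s5]
  rw [s1] at n1 ⊢
  rw [s2] at n2 ⊢
  generalize qInf x (x ^ 2) = α at *
  generalize qInf (-x) (x ^ 2) = β at *
  generalize qInf (x ^ 2) (x ^ 2) = e2 at *
  generalize qInf (x ^ 4) (x ^ 4) = e4 at *
  generalize qInf (x ^ 8) (x ^ 8) = e8 at *
  generalize qInf (-x ^ 8) (x ^ 8) = δ at *
  have hα : α ≠ 0 := left_ne_zero_of_mul n1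
  have hβ : β ≠ 0 := left_ne_zero_of_mul n2
  have t5 : β ^ 2 - α ^ 2 = 4 * x * e8 * δ ^ 2 / e2 := by
    rw [eq_div_iff n3]
    linear_combination t4
  have t6 : 1 / (α * e2) ^ 2 - 1 / (β * e2) ^ 2 = (β ^ 2 - α ^ 2) / (α ^ 2 * β ^ 2 * e2 ^ 2) := by
    field_simp
  rw [t6, t5, s4]
  field_simp

lemma tsum_u_eq (hq : ‖q‖ < 1) :
    ∑' n, (u n : ℂ) * q ^ n = 2 * q ^ 2 * V (q ^ 4) * psi q := by
  have h2 := norm_pow_lt_one hq two_ne_zero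
  have n1 := qInf_self_ne_zero hq
  have n2 := qInf_self_ne_zero h2
  have h := inv_sq_sub_inv_sq h2
  rw [← pow_mul] at h
  norm_num only at h
  have hp : (qInf q q)⁻¹ = psi q * (1 / qInf (q ^ 2) (q ^ 2) ^ 2) := by
    rw [← psi_mul_qInf hq] at *
    have := psi_mul_qInf hq
    have n3 : psi q ≠ 0 := by
      intro h0
      rw [h0, zero_mul] at this
      exact pow_ne_zero 2 n2 this.symm
    field_simp
  have h3 := tsum_u hq
  rw [hp] at h3
  linear_combination h3 / 2 + psi q / 2 * h

end Products

/-! ### The 4-dissection. -/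

section Dissection

open Complex

lemma sum_I_pow (m : ℕ) : ∑ k ∈ range 4, I ^ (k * m) = if m % 4 = 0 then 4 else 0 := by
  have h : ∀ k, I ^ (k * m) = (I ^ (m % 4)) ^ k := fun k => by
    rw [← I_pow_eq_pow_mod, ← pow_mul, mul_comm]
  simp only [h]
  have := Nat.mod_lt m (show 4 > 0 by norm_num)
  interval_cases m % 4 <;> norm_num [sum_range_succ, pow_succ]

/-- Extraction of the terms with exponent `≡ r (mod 4)` by averaging. -/
lemma tsum_ite_mod_four {ι : Type*} {c : ι → ℂ} {e : ι → ℕ} {w : ℂ}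
    (hs : Summable fun x => c x * w ^ e x) {r : ℕ} (hr : r < 4) :
    ∑' x, (if e x % 4 = r then c x * w ^ e x else 0) =
      1 / 4 * ∑ k ∈ range 4, I ^ (k * (3 * r)) * ∑' x, c x * (I ^ k * w) ^ e x := by
  have hsk : ∀ k ∈ range 4, Summable fun x => I ^ (k * (3 * r)) * (c x * (I ^ k * w) ^ e x) := by
    intro k _
    refine Summable.mul_left _ (hs.norm.of_norm_bounded fun x => le_of_eq ?_)
    rw [norm_mul, norm_mul, norm_pow, norm_pow, norm_mul, norm_pow, norm_I, one_pow, one_mul]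
  simp only [← tsum_mul_left]
  rw [← Summable.tsum_finsetSum hsk, ← tsum_mul_left]
  refine tsum_congr fun x => ?_
  -- The weight I^(3rk) equals I^(-rk), so averaging selects the exponents congruent to r.
  have h : ∀ k ∈ range 4, I ^ (k * (3 * r)) * (c x * (I ^ k * w) ^ e x) =
      I ^ (k * (3 * r + e x)) * (c x * w ^ e x) := fun k _ => by
    rw [mul_pow, ← pow_mul, mul_add, pow_add]
    ring
  rw [sum_congr rfl h, ← sum_mul, sum_I_pow]
  by_cases h1 : e x % 4 = r
  · rw [if_pos h1, if_pos (by omega)]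
    ring
  · rw [if_neg h1, if_neg (by omega)]
    ring

variable {w : ℂ}

/-- V(w⁴) is unchanged when w is multiplied by a power of I, so the residue filter acts on ψ alone.
-/
lemma tsum_u_residue (hw : ‖w‖ < 1) {r : ℕ} (hr : r < 4) :
    ∑' n, (u (4 * n + r) : ℂ) * w ^ (4 * n + r) =
      ∑' m : ℤ, if (tri (2 * m) + 2) % 4 = r then
        2 * V (w ^ 4) * w ^ (tri (2 * m) + 2) else 0 := by
  have hg : Function.Injective fun n : ℕ => 4 * n + r := fun m n h => by
    simp only at h
    omega
  have h1 : ∑' n, (u (4 * n + r) : ℂ) * w ^ (4 * n + r) =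
      ∑' n, if n % 4 = r then (u n : ℂ) * w ^ n else 0 := by
    rw [← hg.tsum_eq (f := fun n => if n % 4 = r then (u n : ℂ) * w ^ n else 0)]
    · refine tsum_congr fun n => ?_
      rw [if_pos (by omega)]
    · intro n hn
      by_contra h
      refine hn (if_neg fun hnr => h ⟨n / 4, ?_⟩)
      simp only
      omega
  have hsum : ∀ {v : ℂ}, ‖v‖ < 1 →
      Summable fun m : ℤ => 2 * V (w ^ 4) * v ^ (tri (2 * m) + 2) := fun hv => by
    simp only [pow_add]
    exact ((summable_pow_tri_two_mul hv).mul_right _).mul_left _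
  rw [h1, tsum_ite_mod_four (e := fun n => n) (summable_u hw) hr,
    tsum_ite_mod_four (hsum hw) hr]
  congr 1
  refine sum_congr rfl fun k _ => ?_
  congr 1
  have hk : ‖I ^ k * w‖ < 1 := by simpa using hw
  have h4 : (I ^ k * w) ^ 4 = w ^ 4 := by
    rw [mul_pow, ← pow_mul, mul_comm k, pow_mul, I_pow_four, one_pow, one_mul]
  rw [tsum_u_eq hk, psi_eq_tsum, ← tsum_mul_left, h4]
  refine tsum_congr fun m => ?_
  rw [pow_add]
  ring

/-- One component of the `4`-dissection, selected by the residue `c` of the summation index. -/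
lemma hasSum_u_residue (hw : ‖w‖ < 1) (hw0 : w ≠ 0) {r : ℕ} (hr : r < 4) (c : ℤ) (A B h : ℕ)
    (hAB : A + B = 16)
    (hexp : ∀ k : ℤ, tri (2 * (4 * k + c)) + 2 = 4 * (h + (A * tri k + B * tri (k - 1))) + r)
    (hsupp : ∀ m : ℤ, (tri (2 * m) + 2) % 4 = r → ∃ k, 4 * k + c = m) :
    HasSum (fun n => (u (4 * n + r) : ℂ) * (w ^ 4) ^ n)
      (2 * (w ^ 4) ^ h * qInf ((w ^ 4) ^ 16) ((w ^ 4) ^ 16) * qInf (-(w ^ 4) ^ B) ((w ^ 4) ^ 16) *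
        qInf (-(w ^ 4) ^ A) ((w ^ 4) ^ 16) * V (w ^ 4)) := by
  have hg : Function.Injective fun k : ℤ => 4 * k + c := fun m n h => by
    simp only at h
    omega
  have hwr : w ^ r ≠ 0 := pow_ne_zero r hw0
  have hs : Summable fun n => (u (4 * n + r) : ℂ) * (w ^ 4) ^ n := by
    have hgn : Function.Injective fun n : ℕ => 4 * n + r := fun m n h => by
      simp only at h
      omega
    refine (((summable_u hw).comp_injective hgn).mul_right (w ^ r)⁻¹).congr fun n => ?_
    simp only [Function.comp_apply]
    rw [pow_add, pow_mul]
    field_simp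
  have hmul : (w ^ 4) ^ A * (w ^ 4) ^ B = (w ^ 4) ^ 16 := by rw [← pow_add, hAB]
  have hJ := theta_eq_qInf (a := (w ^ 4) ^ A) (b := (w ^ 4) ^ B) (by
    rw [hmul, ← pow_mul]
    exact norm_pow_lt_one hw (by norm_num))
  rw [hmul] at hJ
  have h1 := tsum_u_residue hw hr
  have h2 : (∑' m : ℤ, if (tri (2 * m) + 2) % 4 = r then
      2 * V (w ^ 4) * w ^ (tri (2 * m) + 2) else 0) =
      2 * V (w ^ 4) * (w ^ 4) ^ h * w ^ r * theta ((w ^ 4) ^ A) ((w ^ 4) ^ B) := by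
    rw [← hg.tsum_eq]
    · rw [theta, ← tsum_mul_left]
      refine tsum_congr fun k => ?_
      rw [if_pos (by rw [hexp]; omega), hexp, thetaTerm, pow_add, pow_mul, pow_add, pow_add,
        pow_mul _ A, pow_mul _ B]
      ring
    · intro m hm
      by_contra hn
      exact hm (if_neg fun hmr => hn (hsupp m hmr))
  have h3 : ∑' n, (u (4 * n + r) : ℂ) * w ^ (4 * n + r) =
      (∑' n, (u (4 * n + r) : ℂ) * (w ^ 4) ^ n) * w ^ r := by
    rw [← tsum_mul_right]
    refine tsum_congr fun n => ?_
    rw [pow_add, pow_mul]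
    ring
  have h4 := hs.hasSum
  convert h4 using 1
  refine mul_right_cancel₀ hwr ?_
  rw [← h3, h1, h2, hJ]
  ring

lemma tri_two_mul_eq (m : ℤ) : (tri (2 * m) : ℤ) = 2 * (m * m) + m := by
  have := two_mul_tri (2 * m)
  linarith

/-- As m² ≡ m (mod 2), one has 2m² + m ≡ 3m (mod 4), which determines m modulo 4. -/
lemma exists_of_tri_mod_four {r : ℕ} {c : ℤ} (h : (2 * (c * c) + c + 2 - r) % 4 = 0) (m : ℤ)
    (hm : (tri (2 * m) + 2) % 4 = r) : ∃ k, 4 * k + c = m := by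
  have h1 := tri_two_mul_eq m
  have hm' : m * m % 2 = m % 2 := by
    rcases Int.emod_two_eq_zero_or_one m with h | h <;> rw [Int.mul_emod, h] <;> rfl
  have hc' : c * c % 2 = c % 2 := by
    rcases Int.emod_two_eq_zero_or_one c with h | h <;> rw [Int.mul_emod, h] <;> rfl
  exact ⟨(m - c) / 4, by omega⟩

/-- Compare coefficients in k: A + B = 16 matches the quadratic term, 16c + 4 = 2(A - B) the linear
one, and 2c² + c + 2 = 4h + r the constant. -/
lemma tri_exponent {r A B h : ℕ} {c : ℤ} (hAB : A + B = 16) (hc : 16 * c + 4 = 2 * (A - B))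
    (hr : 2 * (c * c) + c + 2 = 4 * h + r) (k : ℤ) :
    tri (2 * (4 * k + c)) + 2 = 4 * (h + (A * tri k + B * tri (k - 1))) + r := by
  have h1 := tri_two_mul_eq (4 * k + c)
  have h2 := tri_eq k
  have h3 := two_mul_tri k
  have hB : (B : ℤ) = 16 - A := by omega
  zify
  rw [h1, hB]
  rw [hB] at hc
  linear_combination (-32) * h3 + hr + (64 - 4 * A) * h2 + k * hc

end Dissection

/-! ### The point q = 0 and the conclusion. -/

lemma qInf_zero_left (c : ℂ) : qInf 0 c = 1 := by
  simp [qInf]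

lemma V_zero : V 0 = 1 := by
  simp [V, qInf_zero_left]

lemma hasSum_u_at_zero (r : ℕ) : HasSum (fun n => (u (4 * n + r) : ℂ) * 0 ^ n) (u r) := by
  have := hasSum_single (f := fun n => (u (4 * n + r) : ℂ) * 0 ^ n) 0
    fun n hn => by rw [zero_pow hn, mul_zero]
  simpa using this

end StanleyPartition

open StanleyPartition in
theorem theorem2 (q : ℂ) (hq : ‖q‖ < 1) :
    HasSum (fun n : ℕ => (StanleyPartition.u (4 * n) : ℂ) * q ^ n)
      (2 * q ^ 2 * StanleyPartition.qInf (q ^ 16) (q ^ 16) *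
        StanleyPartition.qInf (-q) (q ^ 16) * StanleyPartition.qInf (-q ^ 15) (q ^ 16) *
        StanleyPartition.V q) ∧
    HasSum (fun n : ℕ => (StanleyPartition.u (4 * n + 1) : ℂ) * q ^ n)
      (2 * q * StanleyPartition.qInf (q ^ 16) (q ^ 16) *
        StanleyPartition.qInf (-q ^ 3) (q ^ 16) * StanleyPartition.qInf (-q ^ 13) (q ^ 16) *
        StanleyPartition.V q) ∧
    HasSum (fun n : ℕ => (StanleyPartition.u (4 * n + 2) : ℂ) * q ^ n)
      (2 * StanleyPartition.qInf (q ^ 16) (q ^ 16) *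
        StanleyPartition.qInf (-q ^ 7) (q ^ 16) * StanleyPartition.qInf (-q ^ 9) (q ^ 16) *
        StanleyPartition.V q) ∧
    HasSum (fun n : ℕ => (StanleyPartition.u (4 * n + 3) : ℂ) * q ^ n)
      (2 * StanleyPartition.qInf (q ^ 16) (q ^ 16) *
        StanleyPartition.qInf (-q ^ 5) (q ^ 16) * StanleyPartition.qInf (-q ^ 11) (q ^ 16) *
        StanleyPartition.V q) := by
  -- The dissection cancels w^r, so q = 0 is handled separately.
  rcases eq_or_ne q 0 with rfl | hq0
  · have h0 := hasSum_u_at_zero 0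
    have h1 := hasSum_u_at_zero 1
    have h2 := hasSum_u_at_zero 2
    have h3 := hasSum_u_at_zero 3
    rw [u_zero] at h0
    rw [u_one] at h1
    rw [u_two] at h2
    rw [u_three] at h3
    refine ⟨?_, ?_, ?_, ?_⟩
    · simpa using h0
    · simpa using h1
    · simpa [qInf_zero_left, V_zero] using h2
    · simpa [qInf_zero_left, V_zero] using h3
  · obtain ⟨w, rfl⟩ := IsAlgClosed.exists_pow_nat_eq q (show 0 < 4 by norm_num)
    have hw : ‖w‖ < 1 := by
      rw [norm_pow] at hq
      exact (pow_lt_one_iff_of_nonneg (norm_nonneg w) (by norm_num)).1 hq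
    have hw0 : w ≠ 0 := fun h => hq0 (by rw [h, zero_pow (by norm_num)])
    refine ⟨?_, ?_, ?_, ?_⟩
    · have := hasSum_u_residue hw hw0 (r := 0) (by norm_num) (-2) 1 15 2 (by norm_num)
        (tri_exponent (by norm_num) (by norm_num) (by norm_num))
        (exists_of_tri_mod_four (by norm_num))
      simp only [pow_one, add_zero] at this
      convert this using 1
      ring
    · have := hasSum_u_residue hw hw0 (r := 1) (by norm_num) 1 13 3 1 (by norm_num)
        (tri_exponent (by norm_num) (by norm_num) (by norm_num))
        (exists_of_tri_mod_four (by norm_num))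
      convert this using 1
      ring
    · have := hasSum_u_residue hw hw0 (r := 2) (by norm_num) 0 9 7 0 (by norm_num)
        (tri_exponent (by norm_num) (by norm_num) (by norm_num))
        (exists_of_tri_mod_four (by norm_num))
      convert this using 1
      ring
    · have := hasSum_u_residue hw hw0 (r := 3) (by norm_num) (-1) 5 11 0 (by norm_num)
        (tri_exponent (by norm_num) (by norm_num) (by norm_num))
        (exists_of_tri_mod_four (by norm_num))
      convert this using 1
      ring
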